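/- Let $G=(V,E,b)$ be a connected power network: a finite connected simple graph $(V,E)$ in which every line $\ell\in E$ has a susceptance $b_\ell>0$ and an arbitrarily chosen orientation. Let $C\in\mathbb R^{V\times E}$ be the incidence matrix ($C_{i\ell}=1$ if $i$ is the source of $\ell$, $-1$ if $i$ is its target, $0$ otherwise), $B=\mathrm{diag}(b_\ell)_{\ell\in E}$, $L=CBC^T$ the weighted Laplacian, and $L^\dagger$ its Moore–Penrose pseudo-inverse. A vector $p\in\mathbb R^V$ of injections is balanced if $p\in\mathrm{im}(L)$; the line flows $f$ for a balanced $p$ are the unique $f\in\mathbb R^E$ with $p=Cf$ and $f=BC^T\theta$ for some $\theta\in\mathbb R^V$ (the DC power flow model). For nodes $s,t\in V$, a balanced $p$ and $\delta\neq 0$, let $f$ and $\tilde f$ be the line flows for $p$ and for $\tilde p=p+\delta(e_s-e_t)$. The power transfer distribution factor (PTDF) of a line $\ell$ is $D_{\ell,st}:=(\tilde f_\ell-f_\ell)/\delta$ (with $D_{\ell,st}:=0$ if $s=t$). For a set of lines $\mathcal E\subseteq E$ put $\beta(\mathcal E):=\prod_{\ell\in\mathcal E}b_\ell$, with $\beta(\emptyset)=1$.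 Let $T$ be the collection of (edge sets of) spanning trees of $G$. For $V_1,V_2\subseteq V$ let $T(V_1,V_2)$ be the collection of (edge sets of) spanning forests of $G$ that consist of exactly two disjoint trees, one containing the nodes in $V_1$ and the other one containing those in $V_2$; it is empty if $V_1\cap V_2\ne\emptyset$. Then for every line $\ell=(i,j)\in E$ with source $i$ and target $j$, all nodes $s,t\in V$, every balanced $p$ and every $\delta\neq0$, one has $\sum_{\mathcal E\in T}\beta(\mathcal E)>0$ and $$D_{\ell,st}\;=\;b_\ell\left(L^\dagger_{is}+L^\dagger_{jt}-L^\dagger_{it}-L^\dagger_{js}\right)\;=\;b_\ell\,\frac{\sum_{\mathcal E\in T(\{i,s\},\{j,t\})}\beta(\mathcal E)-\sum_{\mathcal E\in T(\{i,t\},\{j,s\})}\beta(\mathcal E)}{\sum_{\mathcal E\in T}\beta(\mathcal E)}.$$ In particular $D_{\ell,st}$ does not depend on $p$ and $\delta$. -/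

import Mathlib

/-! ### The Moore–Penrose pseudo-inverse of a real matrix -/

/-- `X` satisfies the four Penrose equations for the real matrix `A`. -/
structure IsMoorePenrose {m n : Type*} [Fintype m] [Fintype n]
    (A : Matrix m n ℝ) (X : Matrix n m ℝ) : Prop where
  mul_mul_self : A * X * A = A
  self_mul_mul : X * A * X = X
  mul_symm : (A * X).transpose = A * X
  symm_mul : (X * A).transpose = X * A

theorem IsMoorePenrose.unique {m n : Type*} [Fintype m] [Fintype n]
    {A : Matrix m n ℝ} {X Y : Matrix n m ℝ}
    (hX : IsMoorePenrose A X) (hY : IsMoorePenrose A Y) : X = Y := by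
  have h1 : A * X = A * Y := by
    calc A * X = (A * X).transpose := hX.mul_symm.symm
      _ = ((A * Y) * (A * X)).transpose := by
          rw [← Matrix.mul_assoc (A * Y), hY.mul_mul_self]
      _ = (A * X) * (A * Y) := by
          rw [Matrix.transpose_mul, hX.mul_symm, hY.mul_symm]
      _ = A * Y := by rw [← Matrix.mul_assoc, hX.mul_mul_self]
  have h2 : X * A = Y * A := by
    calc X * A = (X * A).transpose := hX.symm_mul.symm
      _ = ((X * A) * (Y * A)).transpose := by
          rw [Matrix.mul_assoc X A, ← Matrix.mul_assoc A Y A, hY.mul_mul_self]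
      _ = (Y * A) * (X * A) := by
          rw [Matrix.transpose_mul, hX.symm_mul, hY.symm_mul]
      _ = Y * A := by
          rw [Matrix.mul_assoc Y A, ← Matrix.mul_assoc A X A, hX.mul_mul_self]
  calc X = X * A * X := hX.self_mul_mul.symm
    _ = Y * A * X := by rw [h2]
    _ = Y * A * Y := by rw [Matrix.mul_assoc, h1, ← Matrix.mul_assoc]
    _ = Y := hY.self_mul_mul

theorem exists_isMoorePenrose_of_isHermitian {n : Type*} [Fintype n]
    (H : Matrix n n ℝ) (hH : H.IsHermitian) : ∃ X, IsMoorePenrose H X := by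
  classical
  obtain ⟨U, d, hU, hHU⟩ : ∃ (U : Matrix n n ℝ) (d : n → ℝ),
      U.transpose * U = 1 ∧ H = U * Matrix.diagonal d * U.transpose := by
    refine ⟨hH.eigenvectorUnitary, hH.eigenvalues, ?_, ?_⟩
    · have := (Matrix.mem_unitaryGroup_iff').1 hH.eigenvectorUnitary.2
      simpa [Matrix.star_eq_conjTranspose] using this
    · have := hH.spectral_theorem
      simpa [Unitary.conjStarAlgAut_apply, Matrix.star_eq_conjTranspose,
        Function.comp_def] using this
  have key : ∀ a c : n → ℝ,
      (U * Matrix.diagonal a * U.transpose) * (U * Matrix.diagonal c * U.transpose)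
        = U * Matrix.diagonal (fun i => a i * c i) * U.transpose := by
    intro a c
    calc (U * Matrix.diagonal a * U.transpose) * (U * Matrix.diagonal c * U.transpose)
        = U * Matrix.diagonal a * (U.transpose * U) * Matrix.diagonal c * U.transpose := by
          simp only [Matrix.mul_assoc]
      _ = _ := by
          rw [hU, Matrix.mul_one, Matrix.mul_assoc U, Matrix.diagonal_mul_diagonal]
  have symm : ∀ a : n → ℝ, (U * Matrix.diagonal a * U.transpose).transpose
      = U * Matrix.diagonal a * U.transpose := by
    intro a
    simp [Matrix.transpose_mul, Matrix.mul_assoc]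
  refine ⟨U * Matrix.diagonal (fun i => (d i)⁻¹) * U.transpose, ?_, ?_, ?_, ?_⟩
  · rw [hHU, key, key]
    simp only [mul_inv_mul_cancel]
  · rw [hHU, key, key]
    have : ∀ a : ℝ, a⁻¹ * a * a⁻¹ = a⁻¹ := fun a => by
      simpa using mul_inv_mul_cancel a⁻¹
    simp only [this]
  · rw [hHU, key, symm]
  · rw [hHU, key, symm]

theorem exists_isMoorePenrose {m n : Type*} [Fintype m] [Fintype n]
    (A : Matrix m n ℝ) : ∃ X, IsMoorePenrose A X := by
  classical
  obtain ⟨Y, hY⟩ := exists_isMoorePenrose_of_isHermitian (A.transpose * A)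
    (by simpa using Matrix.isHermitian_conjTranspose_mul_self A)
  have hH : (A.transpose * A).transpose = A.transpose * A := by simp
  have hYt : Y.transpose = Y := by
    refine IsMoorePenrose.unique ⟨?_, ?_, ?_, ?_⟩ hY
    · have := congrArg Matrix.transpose hY.mul_mul_self
      simpa [Matrix.mul_assoc] using this
    · have := congrArg Matrix.transpose hY.self_mul_mul
      simpa [Matrix.mul_assoc] using this
    · have := hY.symm_mul
      rw [Matrix.transpose_mul, hH] at this
      rw [this, Matrix.transpose_mul, hH, this]
    · have := hY.mul_symm
      rw [Matrix.transpose_mul, hH] at this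
      rw [this, Matrix.transpose_mul, hH, this]
  have h1 : A * (Y * (A.transpose * A)) = A := by
    have h0 : A.transpose * A * (Y * (A.transpose * A) - 1) = 0 := by
      rw [Matrix.mul_sub, ← Matrix.mul_assoc, hY.mul_mul_self, Matrix.mul_one, sub_self]
    have h0' : A * (Y * (A.transpose * A) - 1) = 0 := by
      rw [← Matrix.conjTranspose_mul_self_mul_eq_zero]
      simpa using h0
    rw [Matrix.mul_sub, Matrix.mul_one, sub_eq_zero] at h0'
    exact h0'
  refine ⟨Y * A.transpose, ?_, ?_, ?_, ?_⟩
  · simpa [Matrix.mul_assoc] using h1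
  · calc Y * A.transpose * A * (Y * A.transpose)
        = (Y * (A.transpose * A) * Y) * A.transpose := by simp only [Matrix.mul_assoc]
      _ = _ := by rw [hY.self_mul_mul]
  · simp [Matrix.transpose_mul, hYt, Matrix.mul_assoc]
  · have := hY.symm_mul
    simpa [Matrix.mul_assoc] using this

/-- The Moore–Penrose pseudo-inverse of a real matrix: the unique solution of the four Penrose
equations. -/
noncomputable def pinv {m n : Type*} [Fintype m] [Fintype n] (A : Matrix m n ℝ) :
    Matrix n m ℝ :=
  Classical.choose (exists_isMoorePenrose A)

theorem pinv_spec {m n : Type*} [Fintype m] [Fintype n] (A : Matrix m n ℝ) :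
    IsMoorePenrose A (pinv A) :=
  Classical.choose_spec (exists_isMoorePenrose A)

/-! ### Power networks and the DC power flow model -/

/-- A power network: an undirected graph on the set `V` of buses whose edges (the lines) carry
a positive susceptance and an arbitrarily chosen orientation from `source ℓ` to `target ℓ`. -/
structure PowerNetwork (V : Type*) where
  graph : SimpleGraph V
  susceptance : graph.edgeSet → ℝ
  susceptance_pos : ∀ ℓ, 0 < susceptance ℓ
  source : graph.edgeSet → V
  target : graph.edgeSet → V
  source_target : ∀ ℓ, s(source ℓ, target ℓ) = (ℓ : Sym2 V)

namespace PowerNetwork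

/-- The type of lines of a power network. -/
abbrev Line {V : Type*} (N : PowerNetwork V) : Type _ := N.graph.edgeSet

noncomputable instance instFintypeLine {V : Type*} [Fintype V] (N : PowerNetwork V) :
    Fintype N.Line := Fintype.ofFinite _

/-- The vertex-edge incidence matrix `C`. -/
def incidence {V : Type*} [DecidableEq V] (N : PowerNetwork V) : Matrix V N.Line ℝ :=
  Matrix.of fun i ℓ => if i = N.source ℓ then 1 else if i = N.target ℓ then -1 else 0

/-- The diagonal matrix `B` of the susceptances. -/
def susceptanceMatrix {V : Type*} [DecidableEq V] (N : PowerNetwork V) :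
    Matrix N.Line N.Line ℝ :=
  Matrix.diagonal N.susceptance

/-- The weighted Laplacian `L = C B Cᵀ`. -/
noncomputable def laplacian {V : Type*} [Fintype V] [DecidableEq V] (N : PowerNetwork V) :
    Matrix V V ℝ :=
  N.incidence * N.susceptanceMatrix * N.incidence.transpose

/-- An injection vector is balanced if it lies in the image of the Laplacian. -/
def IsBalanced {V : Type*} [Fintype V] [DecidableEq V] (N : PowerNetwork V) (p : V → ℝ) :
    Prop :=
  ∃ θ : V → ℝ, N.laplacian.mulVec θ = p

/-- `f` is a vector of line flows for the injections `p` in the DC power flow model: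
`p = C f` and `f = B Cᵀ θ` for some vector `θ` of phase angles. -/
def IsDCFlow {V : Type*} [Fintype V] [DecidableEq V] (N : PowerNetwork V)
    (p : V → ℝ) (f : N.Line → ℝ) : Prop :=
  p = N.incidence.mulVec f ∧
    ∃ θ : V → ℝ, f = (N.susceptanceMatrix * N.incidence.transpose).mulVec θ

/-- The DC model has a unique vector of line flows for each balanced injection vector. -/
theorem existsUnique_isDCFlow {V : Type*} [Fintype V] [DecidableEq V] (N : PowerNetwork V)
    {p : V → ℝ} (hp : N.IsBalanced p) : ∃! f, N.IsDCFlow p f := by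
  obtain ⟨θ, hθ⟩ := hp
  refine ⟨(N.susceptanceMatrix * N.incidence.transpose).mulVec θ, ⟨?_, θ, rfl⟩, ?_⟩
  · rw [← hθ, Matrix.mulVec_mulVec, laplacian, Matrix.mul_assoc]
  · rintro f ⟨hf, η, hη⟩
    set u : N.Line → ℝ := N.incidence.transpose.mulVec (η - θ) with hu
    have hfu : f - (N.susceptanceMatrix * N.incidence.transpose).mulVec θ
        = N.susceptanceMatrix.mulVec u := by
      rw [hη, hu, Matrix.mulVec_mulVec, Matrix.mulVec_sub]
    have hC : N.incidence.mulVec (N.susceptanceMatrix.mulVec u) = 0 := by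
      rw [← hfu, Matrix.mulVec_sub, ← hf, Matrix.mulVec_mulVec, ← Matrix.mul_assoc,
        ← hθ, laplacian, sub_self]
    have hE : dotProduct u (N.susceptanceMatrix.mulVec u) = 0 := by
      have : dotProduct (η - θ) (N.incidence.mulVec (N.susceptanceMatrix.mulVec u)) = 0 := by
        rw [hC, dotProduct_zero]
      rwa [Matrix.dotProduct_mulVec, ← Matrix.mulVec_transpose] at this
    have hE' : ∑ ℓ : N.Line, N.susceptance ℓ * u ℓ ^ 2 = 0 := by
      rw [← hE]
      refine Finset.sum_congr rfl fun ℓ _ => ?_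
      rw [susceptanceMatrix, Matrix.mulVec_diagonal]
      ring
    have hu0 : ∀ ℓ, N.susceptance ℓ * u ℓ ^ 2 = 0 := fun ℓ =>
      (Finset.sum_eq_zero_iff_of_nonneg
        (fun k _ => mul_nonneg (N.susceptance_pos k).le (sq_nonneg (u k)))).1 hE' ℓ
          (Finset.mem_univ ℓ)
    rw [← sub_eq_zero, hfu]
    funext ℓ
    rw [susceptanceMatrix, Matrix.mulVec_diagonal]
    rcases mul_eq_zero.1 (hu0 ℓ) with h | h
    · simp [h]
    · simp [pow_eq_zero_iff (two_ne_zero) |>.1 h]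

open Classical in
/-- The line flows determined by the DC model for the injections `p`, with the value `0` when
the model has no solution, that is, when `p` is not balanced. -/
noncomputable def flow {V : Type*} [Fintype V] [DecidableEq V] (N : PowerNetwork V)
    (p : V → ℝ) : N.Line → ℝ :=
  if h : ∃ f, N.IsDCFlow p f then Classical.choose h else 0

/-- The power transfer distribution factor: the change of the flow on the line `ℓ`, divided by
`δ`, when the injections change from `p` to `p + δ (e_s - e_t)`; it is `0` for `s = t`. -/
noncomputable def ptdf {V : Type*} [Fintype V] [DecidableEq V] (N : PowerNetwork V)
    (p : V → ℝ) (δ : ℝ) (ℓ : N.Line) (s t : V) : ℝ :=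
  if s = t then 0
  else (N.flow (p + δ • (Pi.single s 1 - Pi.single t 1)) ℓ - N.flow p ℓ) / δ

/-! ### Spanning trees and spanning forests with two trees -/

/-- The spanning subgraph with vertex set `V` whose edges are the lines in `𝓔`. -/
def spanningSubgraph {V : Type*} (N : PowerNetwork V) (𝓔 : Finset N.Line) : SimpleGraph V :=
  SimpleGraph.fromEdgeSet ((fun ℓ : N.Line => (ℓ : Sym2 V)) '' (𝓔 : Set N.Line))

open Classical in
/-- The collection `T` of spanning trees, each given by its set of lines. -/
noncomputable def spanningTrees {V : Type*} [Fintype V] (N : PowerNetwork V) :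
    Finset (Finset N.Line) :=
  Finset.univ.filter fun 𝓔 => (N.spanningSubgraph 𝓔).IsTree

open Classical in
/-- The collection `T(V₁, V₂)` of spanning forests that consist of exactly two trees, one
containing `V₁` and the other one containing `V₂`, each given by its set of lines. -/
noncomputable def twoForests {V : Type*} [Fintype V] (N : PowerNetwork V) (V₁ V₂ : Set V) :
    Finset (Finset N.Line) :=
  Finset.univ.filter fun 𝓔 =>
    (N.spanningSubgraph 𝓔).IsAcyclic ∧
      ∃ c₁ c₂ : (N.spanningSubgraph 𝓔).ConnectedComponent,
        c₁ ≠ c₂ ∧ (∀ c, c = c₁ ∨ c = c₂) ∧ V₁ ⊆ c₁.supp ∧ V₂ ⊆ c₂.supp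

/-- The weight `β(𝓔)`, the product of the susceptances of the lines in `𝓔`. The empty set has
weight `1`. -/
noncomputable def weight {V : Type*} (N : PowerNetwork V) (𝓔 : Finset N.Line) : ℝ :=
  ∏ ℓ ∈ 𝓔, N.susceptance ℓ

end PowerNetwork

/-! By linearity, the flow change per unit of transfer is `B Cᵀ θ` for any `θ` with `L θ = e_s -
e_t`; uniqueness of the DC flow makes the choice of `θ` irrelevant. Two choices give the two
formulas. One is `L† (e_s - e_t)`.

The other is combinatorial and needs no determinants. Each spanning tree carries a unit flow from
`s` to `t` along its path; summed with weights `β`, these have divergence `τ (e_s - e_t)`, where `τ`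
is the total tree weight. Removing `ℓ` from a tree whose path uses `ℓ` leaves a two-tree forest
separating `s` from `t` and the ends of `ℓ`, so the sum on `ℓ` is `b_ℓ` times a difference of forest
counts (`susceptance_mul_sum_twoForests`). That difference is a potential drop
(`forestPotential_sub`), so the summed flow obeys the DC law. Hence
`laplacian_mulVec_forestPotential`, and `θ` is the forest potential over `τ`. -/

theorem SimpleGraph.Reachable.of_sup_edge {V : Type*} {G : SimpleGraph V} {x y a b : V}
    (h : (G ⊔ SimpleGraph.edge x y).Reachable a b) :
    G.Reachable a b ∨ (G.Reachable a x ∧ G.Reachable y b) ∨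
      (G.Reachable a y ∧ G.Reachable x b) := by
  obtain ⟨w⟩ := h
  induction w with
  | nil => exact Or.inl (SimpleGraph.Reachable.refl _)
  | @cons a c b hac _ ih =>
    rw [SimpleGraph.sup_adj, SimpleGraph.edge_adj] at hac
    rcases hac with hac | ⟨⟨rfl, rfl⟩ | ⟨rfl, rfl⟩, _⟩
    · have h := hac.reachable
      rcases ih with ih | ⟨h1, h2⟩ | ⟨h1, h2⟩
      · exact Or.inl (h.trans ih)
      · exact Or.inr (Or.inl ⟨h.trans h1, h2⟩)
      · exact Or.inr (Or.inr ⟨h.trans h1, h2⟩)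
    -- The walk starts with the new edge; if the rest crosses it again, only what follows that later
    -- crossing is kept.
    · rcases ih with ih | ⟨_, h2⟩ | ⟨_, h2⟩
      · exact Or.inr (Or.inl ⟨.refl _, ih⟩)
      · exact Or.inr (Or.inl ⟨.refl _, h2⟩)
      · exact Or.inl h2
    · rcases ih with ih | ⟨_, h2⟩ | ⟨_, h2⟩
      · exact Or.inr (Or.inr ⟨.refl _, ih⟩)
      · exact Or.inl h2
      · exact Or.inr (Or.inr ⟨.refl _, h2⟩)

/-- Adding an edge between two non-adjacent vertices gives a tree exactly when the graph was a
forest with two components that the edge joins. -/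
theorem SimpleGraph.isTree_sup_edge_iff {V : Type*} {G : SimpleGraph V} {x y : V}
    (hxy : x ≠ y) (hG : ¬ G.Adj x y) :
    (G ⊔ SimpleGraph.edge x y).IsTree ↔
      G.IsAcyclic ∧ ¬ G.Reachable x y ∧ ∀ v, G.Reachable x v ∨ G.Reachable y v := by
  have hadj : (G ⊔ SimpleGraph.edge x y).Adj x y := by
    simp [SimpleGraph.edge_adj, hxy]
  constructor
  · intro h
    have hac := SimpleGraph.isAcyclic_sup_fromEdgeSet_iff.1 h.isAcyclic
    refine ⟨hac.1, fun hr => (hac.2 hr).elim hxy hG, fun v => ?_⟩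
    rcases (h.connected.preconnected x v).of_sup_edge with h | ⟨_, h⟩ | ⟨_, h⟩
    · exact Or.inl h
    · exact Or.inr h
    · exact Or.inl h
  · rintro ⟨hac, hr, hv⟩
    refine ⟨?_, hac.sup_edge_of_not_reachable hr⟩
    refine (SimpleGraph.connected_iff_exists_forall_reachable _).2 ⟨x, fun v => ?_⟩
    rcases hv v with h | h
    · exact h.mono le_sup_left
    · exact hadj.reachable.trans (h.mono le_sup_left)

namespace PowerNetwork

/-! ### Spanning trees and two-tree forests as sets of lines -/

theorem source_ne_target {V : Type*} (N : PowerNetwork V) (ℓ : N.Line) :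
    N.source ℓ ≠ N.target ℓ := by
  have h := ℓ.2
  rw [← N.source_target ℓ, SimpleGraph.mem_edgeSet] at h
  exact h.ne

theorem spanningSubgraph_adj {V : Type*} (N : PowerNetwork V) (𝓔 : Finset N.Line) {a b : V} :
    (N.spanningSubgraph 𝓔).Adj a b ↔ ∃ ℓ ∈ 𝓔, (ℓ : Sym2 V) = s(a, b) := by
  simp only [spanningSubgraph, SimpleGraph.fromEdgeSet_adj, Set.mem_image, Finset.mem_coe]
  refine ⟨And.left, ?_⟩
  rintro ⟨ℓ, hℓ, h⟩
  refine ⟨⟨ℓ, hℓ, h⟩, ?_⟩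
  have h' := ℓ.2
  rw [h, SimpleGraph.mem_edgeSet] at h'
  exact h'.ne

theorem spanningSubgraph_adj_source_target {V : Type*} (N : PowerNetwork V)
    (𝓔 : Finset N.Line) (ℓ : N.Line) :
    (N.spanningSubgraph 𝓔).Adj (N.source ℓ) (N.target ℓ) ↔ ℓ ∈ 𝓔 := by
  rw [spanningSubgraph_adj, N.source_target]
  exact ⟨fun ⟨k, hk, h⟩ => Subtype.ext h ▸ hk, fun h => ⟨ℓ, h, rfl⟩⟩

theorem spanningSubgraph_insert {V : Type*} [DecidableEq V] (N : PowerNetwork V)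
    (𝓔 : Finset N.Line) (ℓ : N.Line) :
    N.spanningSubgraph (insert ℓ 𝓔) =
      N.spanningSubgraph 𝓔 ⊔ SimpleGraph.edge (N.source ℓ) (N.target ℓ) := by
  rw [spanningSubgraph, spanningSubgraph, SimpleGraph.edge, ← SimpleGraph.fromEdgeSet_union,
    N.source_target, Finset.coe_insert, Set.image_insert_eq, Set.union_singleton]

theorem isTree_insert_iff {V : Type*} [DecidableEq V] (N : PowerNetwork V)
    {𝓔 : Finset N.Line} {ℓ : N.Line} (hℓ : ℓ ∉ 𝓔) :
    (N.spanningSubgraph (insert ℓ 𝓔)).IsTree ↔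
      (N.spanningSubgraph 𝓔).IsAcyclic ∧
        ¬ (N.spanningSubgraph 𝓔).Reachable (N.source ℓ) (N.target ℓ) ∧
        ∀ v, (N.spanningSubgraph 𝓔).Reachable (N.source ℓ) v ∨
          (N.spanningSubgraph 𝓔).Reachable (N.target ℓ) v := by
  rw [spanningSubgraph_insert, SimpleGraph.isTree_sup_edge_iff (N.source_ne_target ℓ)]
  rwa [spanningSubgraph_adj_source_target]

/-- The nodes `s` and `t` serve as base points: they determine the two components, which turns the
existential into plain reachability. -/
theorem mem_twoForests_pair {V : Type*} [Fintype V] (N : PowerNetwork V) {𝓔 : Finset N.Line}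
    {a b s t : V} :
    𝓔 ∈ N.twoForests {a, s} {b, t} ↔
      (N.spanningSubgraph 𝓔).IsAcyclic ∧ ¬ (N.spanningSubgraph 𝓔).Reachable s t ∧
        (∀ v, (N.spanningSubgraph 𝓔).Reachable s v ∨ (N.spanningSubgraph 𝓔).Reachable t v) ∧
        (N.spanningSubgraph 𝓔).Reachable s a ∧ (N.spanningSubgraph 𝓔).Reachable t b := by
  simp only [twoForests, Finset.mem_filter, Finset.mem_univ, true_and, Set.insert_subset_iff,
    Set.singleton_subset_iff, SimpleGraph.ConnectedComponent.mem_supp_iff]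
  refine and_congr_right fun _ => ⟨?_, ?_⟩
  · rintro ⟨_, _, hne, hall, ⟨ha, rfl⟩, hb, rfl⟩
    simp only [ne_eq, SimpleGraph.ConnectedComponent.eq] at *
    refine ⟨hne, fun v => ?_, ha.symm, hb.symm⟩
    rcases hall (SimpleGraph.connectedComponentMk _ v) with h | h
    · exact Or.inl (SimpleGraph.ConnectedComponent.eq.1 h).symm
    · exact Or.inr (SimpleGraph.ConnectedComponent.eq.1 h).symm
  · rintro ⟨hne, hall, ha, hb⟩
    refine ⟨SimpleGraph.connectedComponentMk _ s, SimpleGraph.connectedComponentMk _ t,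
      fun h => hne (SimpleGraph.ConnectedComponent.eq.1 h), fun c => ?_,
      ⟨SimpleGraph.ConnectedComponent.eq.2 ha.symm, rfl⟩,
      SimpleGraph.ConnectedComponent.eq.2 hb.symm, rfl⟩
    induction c using SimpleGraph.ConnectedComponent.ind with
    | h v =>
      exact (hall v).imp (fun h => SimpleGraph.ConnectedComponent.eq.2 h.symm)
        (fun h => SimpleGraph.ConnectedComponent.eq.2 h.symm)

theorem twoForests_comm {V : Type*} [Fintype V] (N : PowerNetwork V) (V₁ V₂ : Set V) :
    N.twoForests V₁ V₂ = N.twoForests V₂ V₁ := by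
  ext 𝓔
  simp only [twoForests, Finset.mem_filter, Finset.mem_univ, true_and]
  refine and_congr_right fun _ => ⟨?_, ?_⟩ <;>
    exact fun ⟨c, d, hne, hall, h1, h2⟩ => ⟨d, c, hne.symm, fun e => (hall e).symm, h2, h1⟩

theorem mem_spanningTrees {V : Type*} [Fintype V] (N : PowerNetwork V) {𝓔 : Finset N.Line} :
    𝓔 ∈ N.spanningTrees ↔ (N.spanningSubgraph 𝓔).IsTree := by
  simp [spanningTrees]

/-- The two-tree forests separating the ends of `ℓ` are the spanning trees through `ℓ` with `ℓ`
removed. -/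
theorem mem_twoForests_source_target {V : Type*} [Fintype V] [DecidableEq V]
    (N : PowerNetwork V) {𝓔 : Finset N.Line} {ℓ : N.Line} {s t : V} :
    𝓔 ∈ N.twoForests {N.source ℓ, s} {N.target ℓ, t} ↔
      ℓ ∉ 𝓔 ∧ insert ℓ 𝓔 ∈ N.spanningTrees ∧
        (N.spanningSubgraph 𝓔).Reachable (N.source ℓ) s ∧
        (N.spanningSubgraph 𝓔).Reachable (N.target ℓ) t := by
  -- The swaps make the ends of `ℓ` the base points.
  rw [Set.pair_comm, Set.pair_comm (N.target ℓ), mem_twoForests_pair, mem_spanningTrees]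
  constructor
  · rintro ⟨h1, h2, h3, h4, h5⟩
    have hℓ : ℓ ∉ 𝓔 := fun h =>
      h2 ((N.spanningSubgraph_adj_source_target 𝓔 ℓ).2 h).reachable
    exact ⟨hℓ, (N.isTree_insert_iff hℓ).2 ⟨h1, h2, h3⟩, h4, h5⟩
  · rintro ⟨hℓ, h, h4, h5⟩
    obtain ⟨h1, h2, h3⟩ := (N.isTree_insert_iff hℓ).1 h
    exact ⟨h1, h2, h3, h4, h5⟩

theorem spanningTrees_nonempty {V : Type*} [Fintype V] (N : PowerNetwork V)
    (hN : N.graph.Connected) : N.spanningTrees.Nonempty := by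
  classical
  obtain ⟨T, hle, hT⟩ := hN.exists_isTree_le
  refine ⟨Finset.univ.filter fun ℓ : N.Line => (ℓ : Sym2 V) ∈ T.edgeSet, ?_⟩
  rw [mem_spanningTrees]
  convert hT
  ext a b
  rw [spanningSubgraph_adj]
  constructor
  · rintro ⟨ℓ, hℓ, h⟩
    simpa [h] using hℓ
  · intro h
    exact ⟨⟨s(a, b), hle h⟩, by simpa using h, rfl⟩

theorem weight_pos {V : Type*} (N : PowerNetwork V) (𝓔 : Finset N.Line) : 0 < N.weight 𝓔 :=
  Finset.prod_pos fun ℓ _ => N.susceptance_pos ℓ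

theorem sum_weight_spanningTrees_pos {V : Type*} [Fintype V] (N : PowerNetwork V)
    (hN : N.graph.Connected) : 0 < ∑ 𝓔 ∈ N.spanningTrees, N.weight 𝓔 :=
  Finset.sum_pos (fun 𝓔 _ => N.weight_pos 𝓔) (N.spanningTrees_nonempty hN)

/-! ### Unit flows in trees -/

open Classical in
/-- For a set of lines `𝓔` and a node `s`, the indicator of the lines of `𝓔` whose source stays
connected to `s` when the line is removed from `𝓔`. -/
noncomputable def sourceSide {V : Type*} [DecidableEq V] (N : PowerNetwork V)
    (𝓔 : Finset N.Line) (s : V) : N.Line → ℝ :=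
  fun ℓ => if ℓ ∈ 𝓔 ∧ (N.spanningSubgraph (𝓔.erase ℓ)).Reachable (N.source ℓ) s then 1 else 0

theorem incidence_mulVec_single {V : Type*} [Fintype V] [DecidableEq V] (N : PowerNetwork V)
    (ℓ : N.Line) :
    N.incidence.mulVec (Pi.single ℓ 1) =
      Pi.single (N.source ℓ) 1 - Pi.single (N.target ℓ) 1 := by
  have hne := N.source_ne_target ℓ
  rw [Matrix.mulVec_single_one]
  ext v
  simp only [Matrix.col_apply, incidence, Matrix.of_apply, Pi.sub_apply, Pi.single_apply]
  split_ifs with h1 h2 <;> simp_all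

/-- Every edge of a forest is a bridge, so deleting `k` separates the ends of `ℓ` when `k = ℓ`;
otherwise `ℓ` survives and keeps them together. -/
theorem sourceSide_source_sub_target {V : Type*} [DecidableEq V]
    (N : PowerNetwork V) {𝓔 : Finset N.Line}
    (h𝓔 : (N.spanningSubgraph 𝓔).IsAcyclic) {ℓ : N.Line} (hℓ : ℓ ∈ 𝓔) :
    N.sourceSide 𝓔 (N.source ℓ) - N.sourceSide 𝓔 (N.target ℓ) = Pi.single ℓ 1 := by
  ext k
  simp only [Pi.sub_apply, sourceSide]
  by_cases hk : k = ℓ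
  · subst hk
    have hnr : ¬ (N.spanningSubgraph (𝓔.erase k)).Reachable (N.source k) (N.target k) := by
      have h := h𝓔
      rw [← Finset.insert_erase hℓ, spanningSubgraph_insert,
        SimpleGraph.isAcyclic_sup_fromEdgeSet_iff, spanningSubgraph_adj_source_target] at h
      intro hr
      rcases h.2 hr with h | h
      · exact N.source_ne_target k h
      · exact Finset.notMem_erase k 𝓔 h
    simp [hℓ, hnr]
  · have hadj : (N.spanningSubgraph (𝓔.erase k)).Adj
        (N.source ℓ) (N.target ℓ) :=
      (N.spanningSubgraph_adj_source_target _ ℓ).2 (by simp [hℓ, Ne.symm hk])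
    rw [Pi.single_eq_of_ne hk, sub_eq_zero]
    congr 1
    exact propext (and_congr_right fun _ =>
      ⟨fun h => h.trans hadj.reachable, fun h => h.trans hadj.symm.reachable⟩)

/-- In a forest, sending one unit along the path between two connected nodes is a unit flow. -/
theorem incidence_mulVec_sourceSide_sub {V : Type*} [Fintype V] [DecidableEq V]
    (N : PowerNetwork V) {𝓔 : Finset N.Line} (h𝓔 : (N.spanningSubgraph 𝓔).IsAcyclic)
    {s t : V} (hst : (N.spanningSubgraph 𝓔).Reachable s t) :
    N.incidence.mulVec (N.sourceSide 𝓔 s - N.sourceSide 𝓔 t) =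
      Pi.single s 1 - Pi.single t 1 := by
  classical
  obtain ⟨w⟩ := hst
  -- The differences telescope along the walk; a line traversed against its orientation only changes
  -- sign.
  induction w with
  | nil => simp
  | @cons a b c hab _ ih =>
    have key : N.incidence.mulVec (N.sourceSide 𝓔 a - N.sourceSide 𝓔 b) =
        Pi.single a 1 - Pi.single b 1 := by
      obtain ⟨ℓ, hℓ, h⟩ := (N.spanningSubgraph_adj 𝓔).1 hab
      have hcol := N.incidence_mulVec_single ℓ
      rw [← N.sourceSide_source_sub_target h𝓔 hℓ] at hcol
      rw [← N.source_target ℓ, Sym2.eq_iff] at h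
      rcases h with ⟨rfl, rfl⟩ | ⟨rfl, rfl⟩
      · exact hcol
      · rw [← neg_sub, Matrix.mulVec_neg, hcol, neg_sub]
    rw [← sub_add_sub_cancel _ (N.sourceSide 𝓔 b), Matrix.mulVec_add, key, ih,
      sub_add_sub_cancel]

/-- Multiplying by `b_ℓ` turns two-tree forests separating the ends of `ℓ` into spanning trees
through `ℓ`. -/
theorem susceptance_mul_sum_twoForests {V : Type*} [Fintype V] [DecidableEq V]
    (N : PowerNetwork V) (ℓ : N.Line) (s t : V) :
    N.susceptance ℓ * ∑ 𝓔 ∈ N.twoForests {N.source ℓ, s} {N.target ℓ, t}, N.weight 𝓔 =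
      ∑ 𝓔 ∈ N.spanningTrees, N.weight 𝓔 * (N.sourceSide 𝓔 s ℓ * (1 - N.sourceSide 𝓔 t ℓ)) := by
  classical
  have hval : ∀ 𝓔 ∈ N.spanningTrees,
      N.weight 𝓔 * (N.sourceSide 𝓔 s ℓ * (1 - N.sourceSide 𝓔 t ℓ)) =
      if ℓ ∈ 𝓔 ∧ (N.spanningSubgraph (𝓔.erase ℓ)).Reachable (N.source ℓ) s ∧
          (N.spanningSubgraph (𝓔.erase ℓ)).Reachable (N.target ℓ) t
        then N.weight 𝓔 else 0 := by
    intro 𝓔 h𝓔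
    simp only [sourceSide]
    by_cases hℓ : ℓ ∈ 𝓔
    · rw [mem_spanningTrees, ← Finset.insert_erase hℓ,
        N.isTree_insert_iff (Finset.notMem_erase ℓ 𝓔)] at h𝓔
      obtain ⟨-, hne, hall⟩ := h𝓔
      -- The two sides of `ℓ` are complementary, so `1 - sourceSide` indicates the target side.
      have ht : (N.spanningSubgraph (𝓔.erase ℓ)).Reachable (N.target ℓ) t ↔
          ¬ (N.spanningSubgraph (𝓔.erase ℓ)).Reachable (N.source ℓ) t :=
        ⟨fun h h' => hne (h'.trans h.symm), fun h => (hall t).resolve_left h⟩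
      by_cases h1 : (N.spanningSubgraph (𝓔.erase ℓ)).Reachable (N.source ℓ) s <;>
      by_cases h2 : (N.spanningSubgraph (𝓔.erase ℓ)).Reachable (N.source ℓ) t <;>
      simp [hℓ, h1, h2, ht]
    · simp [hℓ]
  rw [Finset.sum_congr rfl hval, ← Finset.sum_filter, Finset.mul_sum]
  refine Finset.sum_bij' (fun 𝓔 _ => insert ℓ 𝓔) (fun 𝓔 _ => 𝓔.erase ℓ) ?_ ?_ ?_ ?_ ?_
  · intro 𝓔 h
    obtain ⟨h1, h2, h3, h4⟩ := N.mem_twoForests_source_target.1 h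
    rw [Finset.mem_filter, Finset.erase_insert h1]
    exact ⟨h2, Finset.mem_insert_self _ _, h3, h4⟩
  · intro 𝓔 h
    obtain ⟨h1, h2, h3, h4⟩ := Finset.mem_filter.1 h
    refine N.mem_twoForests_source_target.2 ⟨Finset.notMem_erase ℓ 𝓔, ?_, h3, h4⟩
    rwa [Finset.insert_erase h2]
  · intro 𝓔 h
    exact Finset.erase_insert (N.mem_twoForests_source_target.1 h).1
  · intro 𝓔 h
    exact Finset.insert_erase (Finset.mem_filter.1 h).2.1
  · intro 𝓔 h
    rw [weight, weight, Finset.prod_insert (N.mem_twoForests_source_target.1 h).1]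

/-- The potential at `v` whose differences count the two-tree forests separating `s` from `t`. -/
noncomputable def forestPotential {V : Type*} [Fintype V] (N : PowerNetwork V) (s t : V) :
    V → ℝ :=
  fun v => ∑ 𝓔 ∈ N.twoForests {v, s} {t, t}, N.weight 𝓔

/-- Compared forest by forest: those with `x` and `y` in the same tree cancel, and the others count
with a sign given by which of the two lies with `s`. -/
theorem forestPotential_sub {V : Type*} [Fintype V] (N : PowerNetwork V) (s t x y : V) :
    N.forestPotential s t x - N.forestPotential s t y =
      ∑ 𝓔 ∈ N.twoForests {x, s} {y, t}, N.weight 𝓔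
        - ∑ 𝓔 ∈ N.twoForests {x, t} {y, s}, N.weight 𝓔 := by
  classical
  have hsum : ∀ V₁ V₂ : Set V, ∑ 𝓔 ∈ N.twoForests V₁ V₂, N.weight 𝓔 =
      ∑ 𝓔, if 𝓔 ∈ N.twoForests V₁ V₂ then N.weight 𝓔 else 0 := by
    intro V₁ V₂
    rw [← Finset.sum_filter]
    simp
  -- Now all four families have `s` and `t` as base points.
  rw [N.twoForests_comm {x, t}]
  simp only [forestPotential, hsum, ← Finset.sum_sub_distrib]
  refine Finset.sum_congr rfl fun 𝓔 _ => ?_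
  simp only [mem_twoForests_pair]
  by_cases h : (N.spanningSubgraph 𝓔).IsAcyclic ∧ ¬ (N.spanningSubgraph 𝓔).Reachable s t ∧
      ∀ v, (N.spanningSubgraph 𝓔).Reachable s v ∨ (N.spanningSubgraph 𝓔).Reachable t v
  · obtain ⟨h1, h2, h3⟩ := h
    have ht : ∀ v, (N.spanningSubgraph 𝓔).Reachable t v ↔
        ¬ (N.spanningSubgraph 𝓔).Reachable s v := fun v =>
      ⟨fun h h' => h2 (h'.trans h.symm), fun h => (h3 v).resolve_left h⟩
    by_cases hx : (N.spanningSubgraph 𝓔).Reachable s x <;>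
    by_cases hy : (N.spanningSubgraph 𝓔).Reachable s y <;>
    simp [h1, h2, ht, hx, hy, em]
  · have h' : ∀ P : Prop, ¬ ((N.spanningSubgraph 𝓔).IsAcyclic ∧
        ¬ (N.spanningSubgraph 𝓔).Reachable s t ∧
        (∀ v, (N.spanningSubgraph 𝓔).Reachable s v ∨
          (N.spanningSubgraph 𝓔).Reachable t v) ∧ P) :=
      fun P hP => h ⟨hP.1, hP.2.1, hP.2.2.1⟩
    simp [h']

/-! ### Potentials, flows and the pseudo-inverse -/

theorem susceptanceMatrix_mul_incidence_transpose_mulVec {V : Type*} [Fintype V] [DecidableEq V]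
    (N : PowerNetwork V) (θ : V → ℝ) (ℓ : N.Line) :
    (N.susceptanceMatrix * N.incidence.transpose).mulVec θ ℓ =
      N.susceptance ℓ * (θ (N.source ℓ) - θ (N.target ℓ)) := by
  classical
  have h : N.incidence.transpose.mulVec θ ℓ = θ (N.source ℓ) - θ (N.target ℓ) := by
    have h1 : N.incidence.transpose.mulVec θ ℓ =
        N.incidence.mulVec (Pi.single ℓ 1) ⬝ᵥ θ := by
      rw [Matrix.mulVec_single_one]
      rfl
    rw [h1, incidence_mulVec_single, sub_dotProduct, single_one_dotProduct,
      single_one_dotProduct]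
  rw [← Matrix.mulVec_mulVec, susceptanceMatrix, Matrix.mulVec_diagonal, h]

theorem laplacian_mulVec {V : Type*} [Fintype V] [DecidableEq V] (N : PowerNetwork V)
    (θ : V → ℝ) :
    N.laplacian.mulVec θ =
      N.incidence.mulVec ((N.susceptanceMatrix * N.incidence.transpose).mulVec θ) := by
  rw [Matrix.mulVec_mulVec, laplacian, Matrix.mul_assoc]

/-- Kirchhoff's theorem: the forest potential drives a current from `s` to `t` whose size is the
weighted number of spanning trees. -/
theorem laplacian_mulVec_forestPotential {V : Type*} [Fintype V] [DecidableEq V]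
    (N : PowerNetwork V) (s t : V) :
    N.laplacian.mulVec (N.forestPotential s t) =
      (∑ 𝓔 ∈ N.spanningTrees, N.weight 𝓔) • (Pi.single s 1 - Pi.single t 1) := by
  classical
  have hflow : (N.susceptanceMatrix * N.incidence.transpose).mulVec (N.forestPotential s t) =
      ∑ 𝓔 ∈ N.spanningTrees, N.weight 𝓔 • (N.sourceSide 𝓔 s - N.sourceSide 𝓔 t) := by
    ext ℓ
    rw [susceptanceMatrix_mul_incidence_transpose_mulVec, forestPotential_sub, mul_sub,
      susceptance_mul_sum_twoForests, susceptance_mul_sum_twoForests,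
      ← Finset.sum_sub_distrib, Finset.sum_apply]
    -- For each tree this is `x (1 - y) - y (1 - x) = x - y`.
    refine Finset.sum_congr rfl fun 𝓔 _ => ?_
    simp only [Pi.smul_apply, Pi.sub_apply, smul_eq_mul]
    ring
  rw [laplacian_mulVec, hflow, Matrix.mulVec_sum, Finset.sum_smul]
  refine Finset.sum_congr rfl fun 𝓔 h𝓔 => ?_
  rw [mem_spanningTrees] at h𝓔
  rw [Matrix.mulVec_smul,
    N.incidence_mulVec_sourceSide_sub h𝓔.isAcyclic (h𝓔.connected.preconnected s t)]

theorem flow_eq {V : Type*} [Fintype V] [DecidableEq V] (N : PowerNetwork V) (θ : V → ℝ) :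
    N.flow (N.laplacian.mulVec θ) =
      (N.susceptanceMatrix * N.incidence.transpose).mulVec θ := by
  have h : N.IsDCFlow (N.laplacian.mulVec θ)
      ((N.susceptanceMatrix * N.incidence.transpose).mulVec θ) :=
    ⟨N.laplacian_mulVec θ, θ, rfl⟩
  have hex : ∃ f, N.IsDCFlow (N.laplacian.mulVec θ) f := ⟨_, h⟩
  rw [flow, dif_pos hex]
  exact (N.existsUnique_isDCFlow ⟨θ, rfl⟩).unique (Classical.choose_spec hex) h

/-- Since `L L† L = L`, the potential `L† (e_s - e_t)` solves the same equation as `θ`, and equal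
injections force equal flows. -/
theorem pinv_laplacian_sub {V : Type*} [Fintype V] [DecidableEq V] (N : PowerNetwork V)
    (ℓ : N.Line) {s t : V} {θ : V → ℝ}
    (hθ : N.laplacian.mulVec θ = Pi.single s 1 - Pi.single t 1) :
    N.susceptance ℓ * (pinv N.laplacian (N.source ℓ) s + pinv N.laplacian (N.target ℓ) t
        - pinv N.laplacian (N.source ℓ) t - pinv N.laplacian (N.target ℓ) s) =
      N.susceptance ℓ * (θ (N.source ℓ) - θ (N.target ℓ)) := by
  set η : V → ℝ := (pinv N.laplacian).mulVec (Pi.single s 1 - Pi.single t 1) with hη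
  have hL : N.laplacian.mulVec η = N.laplacian.mulVec θ := by
    rw [hη, ← hθ, Matrix.mulVec_mulVec, Matrix.mulVec_mulVec, (pinv_spec N.laplacian).mul_mul_self]
  have hflow := congrFun (N.flow_eq η) ℓ
  rw [hL, flow_eq, susceptanceMatrix_mul_incidence_transpose_mulVec,
    susceptanceMatrix_mul_incidence_transpose_mulVec] at hflow
  rw [hflow, hη, Matrix.mulVec_sub, Matrix.mulVec_single_one, Matrix.mulVec_single_one]
  simp only [Pi.sub_apply, Matrix.col_apply]
  ring

end PowerNetwork

open PowerNetwork in
theorem mainTheorem5 {V : Type*} [Fintype V] [DecidableEq V] (N : PowerNetwork V)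
    (hN : N.graph.Connected)
    (p : V → ℝ) (hp : N.IsBalanced p) (δ : ℝ) (hδ : δ ≠ 0)
    (ℓ : N.Line) (i j : V) (hi : N.source ℓ = i) (hj : N.target ℓ = j) (s t : V) :
    N.ptdf p δ ℓ s t =
        N.susceptance ℓ *
          (pinv N.laplacian i s + pinv N.laplacian j t
            - pinv N.laplacian i t - pinv N.laplacian j s) ∧
      N.susceptance ℓ *
          (pinv N.laplacian i s + pinv N.laplacian j t
            - pinv N.laplacian i t - pinv N.laplacian j s) =
        N.susceptance ℓ *
          ((∑ 𝓔 ∈ N.twoForests {i, s} {j, t}, N.weight 𝓔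
            - ∑ 𝓔 ∈ N.twoForests {i, t} {j, s}, N.weight 𝓔)
            / ∑ 𝓔 ∈ N.spanningTrees, N.weight 𝓔) ∧
      0 < ∑ 𝓔 ∈ N.spanningTrees, N.weight 𝓔 := by
  subst hi hj
  have hτ := N.sum_weight_spanningTrees_pos hN
  set τ := ∑ 𝓔 ∈ N.spanningTrees, N.weight 𝓔 with hτdef
  set θ : V → ℝ := τ⁻¹ • N.forestPotential s t with hθdef
  have hθ : N.laplacian.mulVec θ = Pi.single s 1 - Pi.single t 1 := by
    rw [hθdef, Matrix.mulVec_smul, laplacian_mulVec_forestPotential, ← hτdef, smul_smul,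
      inv_mul_cancel₀ hτ.ne', one_smul]
  have hpinv := N.pinv_laplacian_sub ℓ hθ
  refine ⟨?_, ?_, hτ⟩
  · rw [hpinv, ptdf]
    split_ifs with hst
    -- The conventional value `0` agrees with the formula, whose terms cancel when `s = t`.
    · subst hst
      rw [← hpinv]
      ring
    -- With `p = L η`, the perturbed injections are `L (η + δ θ)`, so `η` drops out and `δ` cancels.
    · obtain ⟨η, rfl⟩ := hp
      rw [← hθ, ← Matrix.mulVec_smul, ← Matrix.mulVec_add, flow_eq, flow_eq,
        susceptanceMatrix_mul_incidence_transpose_mulVec,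
        susceptanceMatrix_mul_incidence_transpose_mulVec]
      simp only [Pi.add_apply, Pi.smul_apply, smul_eq_mul]
      field_simp
      ring
  · rw [hpinv, ← forestPotential_sub, hθdef]
    simp only [Pi.smul_apply, smul_eq_mul]
    ring
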